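/- Let $1<p<\infty$ and let $\Omega\subset\mathbb{R}^2$ be a domain (a nonempty, open, connected set) of finite Lebesgue measure. Let $u=(u^1,u^2)\in W^{1,p}(\Omega,\mathbb{R}^2)$ be a $p$-harmonic mapping, i.e. a weak solution of the system $$\operatorname{div}\big(|Du|^{p-2}\nabla u^i\big)=0\quad\text{in }\Omega,\qquad i=1,2,$$ where $|Du|^2=|\nabla u^1|^2+|\nabla u^2|^2$; that is, $\int_\Omega |Du|^{p-2}\langle\nabla u^i,\nabla\varphi\rangle\,dx=0$ for all $\varphi\in C_c^\infty(\Omega)$ and $i=1,2$ (with $|Du|^{p-2}\nabla u^i:=0$ where $Du=0$). For $v\in W^{1,p}(\Omega,\mathbb{R})$ and $l\in\mathbb{R}$, say that $v\le l$ on $\partial\Omega$ if there is a sequence $(v_n)$ of Lipschitz functions on $\overline\Omega$ such that $v_n(x)\le l$ for every $x\in\partial\Omega$ and every $n$, and $\|v-v_n\|_{W^{1,p}(\Omega,\mathbb{R})}\to0$ as $n\to\infty$. If for some $i\in\{1,2\}$ and some $k\in\mathbb{R}$ we have $u^i\le k$ on $\partial\Omega$ in this sense, then $u^i\le k$ almost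 everywhere in $\Omega$. -/

import Mathlib

open MeasureTheory Filter Topology
open scoped Gradient ContDiff

/-- The Euclidean plane `ℝ²`. -/
abbrev Plane : Type := EuclideanSpace ℝ (Fin 2)

/-- `φ ∈ C_c^∞(Ω)`: a smooth real function with compact support contained in `Ω`. -/
def IsTestFunction (Ω : Set Plane) (φ : Plane → ℝ) : Prop :=
  ContDiff ℝ ∞ φ ∧ HasCompactSupport φ ∧ tsupport φ ⊆ Ω

/-- `G` is the weak (distributional) gradient of `v` in the open set `Ω`. -/
def HasWeakGradient (Ω : Set Plane) (v : Plane → ℝ) (G : Plane → Plane) : Prop :=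
  LocallyIntegrableOn v Ω volume ∧ LocallyIntegrableOn G Ω volume ∧
    ∀ φ : Plane → ℝ, IsTestFunction Ω φ →
      ∫ x in Ω, v x • ∇ φ x = -∫ x in Ω, φ x • G x

/-- `v ∈ W^{1,p}(Ω, ℝ)`. -/
def MemW1p (p : ℝ) (Ω : Set Plane) (v : Plane → ℝ) : Prop :=
  MemLp v (ENNReal.ofReal p) (volume.restrict Ω) ∧
    ∃ G : Plane → Plane,
      HasWeakGradient Ω v G ∧ MemLp G (ENNReal.ofReal p) (volume.restrict Ω)

/-- `u ∈ W^{1,p}(Ω, ℝ²)`. -/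
def MemW1pMap (p : ℝ) (Ω : Set Plane) (u : Plane → Plane) : Prop :=
  ∀ i : Fin 2, MemW1p p Ω (fun x => u x i)

/-- `v ∈ L^p_loc(Ω)`: the restriction of `v` to each compact subset of `Ω` is in `L^p`. -/
def MemLpLoc {F : Type*} [NormedAddCommGroup F] (p : ℝ) (Ω : Set Plane) (v : Plane → F) : Prop :=
  ∀ K : Set Plane, IsCompact K → K ⊆ Ω → MemLp v (ENNReal.ofReal p) (volume.restrict K)

/-- The norm `|Du| = (|∇u¹|² + |∇u²|²)^{1/2}` of the Jacobi matrix with rows `Du 0`, `Du 1`. -/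
noncomputable def jacobiNorm (Du : Fin 2 → Plane → Plane) (x : Plane) : ℝ :=
  Real.sqrt (‖Du 0 x‖ ^ 2 + ‖Du 1 x‖ ^ 2)

/-- `u ∈ W^{1,p}_loc(Ω, ℝ²)` is `p`-harmonic: a weak solution of
`div (|Du|^{p-2} ∇u^i) = 0`, `i = 1, 2`. Where `Du = 0`, the field `|Du|^{p-2} ∇u^i` is `0`,
whatever the value of the power. -/
def IsPHarmonicMap (p : ℝ) (Ω : Set Plane) (u : Plane → Plane) : Prop :=
  ∃ Du : Fin 2 → Plane → Plane,
    (∀ i, MemLpLoc p Ω (fun x => u x i) ∧ MemLpLoc p Ω (Du i) ∧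
      HasWeakGradient Ω (fun x => u x i) (Du i)) ∧
    ∀ i, ∀ φ : Plane → ℝ, IsTestFunction Ω φ →
      ∫ x in Ω, jacobiNorm Du x ^ (p - 2) * inner ℝ (Du i x) (∇ φ x) = 0

/-- `v ≤ l` on `∂Ω` in the Sobolev sense: there are functions `w n`, Lipschitz on the closure of
`Ω`, with `w n ≤ l` at every point of `∂Ω` and `‖v - w n‖_{W^{1,p}(Ω)} → 0`
(`H n` is the weak gradient of `v - w n`). -/
def SobolevBoundaryLE (p : ℝ) (Ω : Set Plane) (v : Plane → ℝ) (l : ℝ) : Prop :=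
  ∃ (w : ℕ → Plane → ℝ) (H : ℕ → Plane → Plane),
    (∀ n, ∃ L, LipschitzOnWith L (w n) (closure Ω)) ∧
    (∀ n, ∀ x ∈ frontier Ω, w n x ≤ l) ∧
    (∀ n, HasWeakGradient Ω (fun x => v x - w n x) (H n)) ∧
    Tendsto (fun n => eLpNorm (fun x => v x - w n x) (ENNReal.ofReal p) (volume.restrict Ω))
      atTop (𝓝 0) ∧
    Tendsto (fun n => eLpNorm (H n) (ENNReal.ofReal p) (volume.restrict Ω)) atTop (𝓝 0)

/-!
For `l > k` let `S` be a smooth bounded nondecreasing function which vanishes on `(-∞, l]` and is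
positive on `(l, ∞)`. The Lipschitz approximants `w n` of `u^i` are at most `k` on `∂Ω`, so
`S (w n)` vanishes near `∂Ω` and lies in `W₀^{1,p}(Ω)`; letting `n → ∞`, so does `S (u^i)`. It may
therefore be used as a test function, which gives `∫ |Du|^{p-2} S'(u^i) |∇u^i|² = 0`. The integrand
is nonnegative, so `∇ S(u^i) = S'(u^i) ∇u^i = 0` almost everywhere, and `S (u^i) = 0` by the Sobolev
inequality `‖φ‖₂ ≤ C ‖∇ φ‖₁` of the plane, which is available for every `p` because `Ω` has finite
measure. Hence `u^i ≤ l`, and `l` decreases to `k`.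
-/

section LpConvergence

variable {α E : Type*} [MeasurableSpace α] {μ : Measure α} [NormedAddCommGroup E] {p q : ENNReal}

theorem tendsto_eLpNorm_sub_of_dominated (hp0 : p ≠ 0) (hp : p ≠ ⊤) {f : ℕ → α → E} {g : α → E}
    {b : α → ℝ} (hf : ∀ n, AEStronglyMeasurable (f n) μ) (hb : MemLp b p μ)
    (hfb : ∀ n, ∀ᵐ x ∂μ, ‖f n x‖ ≤ b x)
    (h : ∀ᵐ x ∂μ, Tendsto (fun n => f n x) atTop (𝓝 (g x))) :
    Tendsto (fun n => eLpNorm (f n - g) p μ) atTop (𝓝 0) := by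
  have hp' : 0 < p.toReal := ENNReal.toReal_pos hp0 hp
  have hg : AEStronglyMeasurable g μ := aestronglyMeasurable_of_tendsto_ae _ hf h
  have hgb : ∀ᵐ x ∂μ, ‖g x‖ ≤ b x := by
    filter_upwards [h, ae_all_iff.2 hfb] with x hx hxb
    exact le_of_tendsto hx.norm (Eventually.of_forall hxb)
  have hlintegral : Tendsto (fun n => ∫⁻ x, ‖f n x - g x‖ₑ ^ p.toReal ∂μ) atTop
      (𝓝 (∫⁻ _, 0 ∂μ)) := by
    refine tendsto_lintegral_of_dominated_convergence' (fun x => ‖b x + b x‖ₑ ^ p.toReal)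
      (fun n => ((hf n).sub hg).enorm.pow_const _) (fun n => ?_) ?_ ?_
    · filter_upwards [hfb n, hgb] with x hfx hgx
      gcongr
      rw [enorm_le_iff_norm_le]
      exact (norm_sub_le _ _).trans ((add_le_add hfx hgx).trans (Real.le_norm_self _))
    · have hbb := (hb.add hb).2
      rw [eLpNorm_lt_top_iff_lintegral_rpow_enorm_lt_top hp0 hp] at hbb
      exact hbb.ne
    · filter_upwards [h] with x hx
      have hsub : Tendsto (fun n => ‖f n x - g x‖ₑ) atTop (𝓝 0) := by
        simpa using (hx.sub_const (g x)).enorm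
      simpa [ENNReal.zero_rpow_of_pos hp'] using hsub.ennrpow_const p.toReal
  rw [lintegral_zero] at hlintegral
  have hroot := hlintegral.ennrpow_const (1 / p.toReal)
  rw [ENNReal.zero_rpow_of_pos (by positivity)] at hroot
  simpa only [eLpNorm_eq_lintegral_rpow_enorm_toReal hp0 hp, Pi.sub_apply] using hroot

theorem tendsto_eLpNorm_zero_of_exponent_le [IsFiniteMeasure μ] {ι : Type*} {l : Filter ι}
    (hp : p ≠ 0) (hpq : p ≤ q) {f : ι → α → E} (hf : ∀ n, AEStronglyMeasurable (f n) μ)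
    (h : Tendsto (fun n => eLpNorm (f n) q μ) l (𝓝 0)) :
    Tendsto (fun n => eLpNorm (f n) p μ) l (𝓝 0) := by
  have hexp : 0 ≤ 1 / p.toReal - 1 / q.toReal := by
    have := ENNReal.toReal_mono (ENNReal.inv_ne_top.2 hp) (ENNReal.inv_le_inv.2 hpq)
    simpa only [ENNReal.toReal_inv, one_div, sub_nonneg] using this
  have hbound := ENNReal.Tendsto.mul_const h
    (Or.inr (ENNReal.rpow_ne_top_of_nonneg hexp (measure_ne_top μ Set.univ)))
  rw [zero_mul] at hbound
  exact tendsto_of_tendsto_of_tendsto_of_le_of_le tendsto_const_nhds hbound (fun _ => zero_le)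
    fun n => eLpNorm_le_eLpNorm_mul_rpow_measure_univ hpq (hf n)

theorem tendsto_eLpNorm_smul_sub [NormedSpace ℝ E] (hp1 : 1 ≤ p) (hp : p ≠ ⊤)
    {c : ℕ → α → ℝ} {c' : α → ℝ} {F : ℕ → α → E} {F' : α → E} {M : ℝ}
    (hc : ∀ n, AEStronglyMeasurable (c n) μ) (hcM : ∀ n x, ‖c n x‖ ≤ M)
    (hcc' : ∀ᵐ x ∂μ, Tendsto (fun n => c n x) atTop (𝓝 (c' x)))
    (hF : ∀ n, AEStronglyMeasurable (F n) μ) (hF' : MemLp F' p μ)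
    (hFF' : Tendsto (fun n => eLpNorm (F n - F') p μ) atTop (𝓝 0)) :
    Tendsto (fun n => eLpNorm (c n • F n - c' • F') p μ) atTop (𝓝 0) := by
  have hc' : AEStronglyMeasurable c' μ := aestronglyMeasurable_of_tendsto_ae _ hc hcc'
  have hfactor : Tendsto (fun n => eLpNorm (c n • F' - c' • F') p μ) atTop (𝓝 0) := by
    refine tendsto_eLpNorm_sub_of_dominated (zero_lt_one.trans_le hp1).ne' hp
      (fun n => (hc n).smul hF'.1) (hF'.norm.const_mul M)
      (fun n => Eventually.of_forall fun x => ?_) ?_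
    · simpa only [Pi.smul_apply', norm_smul] using
        mul_le_mul_of_nonneg_right (hcM n x) (norm_nonneg (F' x))
    · filter_upwards [hcc'] with x hx
      exact hx.smul_const (F' x)
  have hfield : Tendsto (fun n => eLpNorm (c n • (F n - F')) p μ) atTop (𝓝 0) := by
    have hM := ENNReal.Tendsto.const_mul (a := ENNReal.ofReal M) hFF'
      (Or.inr ENNReal.ofReal_ne_top)
    rw [mul_zero] at hM
    refine tendsto_of_tendsto_of_tendsto_of_le_of_le tendsto_const_nhds hM (fun _ => zero_le)
      fun n => eLpNorm_le_mul_eLpNorm_of_ae_le_mul (Eventually.of_forall fun x => ?_) _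
    simpa only [Pi.smul_apply', norm_smul] using
      mul_le_mul_of_nonneg_right (hcM n x) (norm_nonneg _)
  have hsum := hfield.add hfactor
  rw [add_zero] at hsum
  refine tendsto_of_tendsto_of_tendsto_of_le_of_le tendsto_const_nhds hsum (fun _ => zero_le)
    fun n => ?_
  have hsplit : c n • F n - c' • F' = c n • (F n - F') + (c n • F' - c' • F') := by
    rw [smul_sub]; abel
  exact hsplit ▸ eLpNorm_add_le ((hc n).smul ((hF n).sub hF'.1))
    (((hc n).smul hF'.1).sub (hc'.smul hF'.1)) hp1

theorem integrable_inner_of_memLp [InnerProductSpace ℝ E] [ENNReal.HolderTriple q p 1]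
    {A X : α → E} (hA : MemLp A q μ) (hX : MemLp X p μ) :
    Integrable (fun x => inner ℝ (A x) (X x)) μ :=
  memLp_one_iff_integrable.1 ((innerSL ℝ).memLp_of_bilin 1 hA hX)

theorem tendsto_integral_inner [InnerProductSpace ℝ E] [ENNReal.HolderTriple q p 1]
    {ι : Type*} {l : Filter ι} {A X' : α → E} {X : ι → α → E} (hA : MemLp A q μ)
    (hX : ∀ n, MemLp (X n) p μ) (hX' : MemLp X' p μ)
    (h : Tendsto (fun n => eLpNorm (X n - X') p μ) l (𝓝 0)) :
    Tendsto (fun n => ∫ x, inner ℝ (A x) (X n x) ∂μ) l (𝓝 (∫ x, inner ℝ (A x) (X' x) ∂μ)) := by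
  refine tendsto_integral_of_L1' _ (integrable_inner_of_memLp hA hX').1
    (Eventually.of_forall fun n => integrable_inner_of_memLp hA (hX n)) ?_
  have hHolder := ENNReal.Tendsto.const_mul h (Or.inr hA.2.ne)
  rw [mul_zero] at hHolder
  refine tendsto_of_tendsto_of_tendsto_of_le_of_le tendsto_const_nhds hHolder (fun _ => zero_le)
    fun n => ?_
  have hinner := eLpNorm_le_eLpNorm_mul_eLpNorm'_of_norm (p := q) (q := p) (r := 1) hA.1
    ((hX n).1.sub hX'.1) (inner ℝ) 1 (Eventually.of_forall fun x => by
      simpa using norm_inner_le_norm (𝕜 := ℝ) (A x) (X n x - X' x))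
  simpa only [Pi.sub_apply, Pi.sub_def, inner_sub_right, ENNReal.coe_one, one_mul] using hinner

end LpConvergence

section Mollification

open scoped Convolution

variable {E F : Type*} [NormedAddCommGroup E] [NormedAddCommGroup F] [NormedSpace ℝ F]
  {g : E → F} {L : NNReal}

theorem lipschitzWith_const_smul_comp_sub (hg : LipschitzWith L g) (c : ℝ) (t : E) :
    LipschitzWith (Real.nnabs (c * L)) fun x => c • g (x - t) := by
  refine LipschitzWith.of_dist_le_mul fun x y => ?_
  rw [dist_smul₀, Real.norm_eq_abs, Real.coe_nnabs, abs_mul, NNReal.abs_eq, mul_assoc]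
  exact mul_le_mul_of_nonneg_left (by simpa using hg.dist_le_mul (x - t) (y - t)) (abs_nonneg c)

variable [NormedSpace ℝ E] [FiniteDimensional ℝ E] [MeasurableSpace E] [BorelSpace E]
  {μ : Measure E} [μ.IsAddHaarMeasure]

theorem integrable_normed_smul_comp_sub (ρ : ContDiffBump (0 : E)) (hg : Continuous g) (x : E) :
    Integrable (fun t => ρ.normed μ t • g (x - t)) μ :=
  (ρ.continuous_normed.smul (hg.comp (continuous_sub_left x))).integrable_of_hasCompactSupport
    ρ.hasCompactSupport_normed.smul_right

theorem lipschitzWith_normed_convolution (ρ : ContDiffBump (0 : E)) (hg : LipschitzWith L g) :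
    LipschitzWith L (ρ.normed μ ⋆[ContinuousLinearMap.lsmul ℝ ℝ, μ] g) := by
  refine LipschitzWith.of_dist_le_mul fun x y => ?_
  have hint := integrable_normed_smul_comp_sub (μ := μ) ρ hg.continuous
  calc dist ((ρ.normed μ ⋆[ContinuousLinearMap.lsmul ℝ ℝ, μ] g) x)
        ((ρ.normed μ ⋆[ContinuousLinearMap.lsmul ℝ ℝ, μ] g) y)
      = ‖∫ t, (ρ.normed μ t • g (x - t) - ρ.normed μ t • g (y - t)) ∂μ‖ := by
        rw [dist_eq_norm, integral_sub (hint x) (hint y)]; rfl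
    _ ≤ ∫ t, ρ.normed μ t * L * dist x y ∂μ := by
        refine norm_integral_le_of_norm_le ((ρ.integrable_normed.mul_const _).mul_const _)
          (Eventually.of_forall fun t => ?_)
        have hlip := (lipschitzWith_const_smul_comp_sub hg (ρ.normed μ t) t).dist_le_mul x y
        rwa [Real.coe_nnabs, abs_mul, NNReal.abs_eq, abs_of_nonneg (ρ.nonneg_normed t),
          dist_eq_norm] at hlip
    _ = L * dist x y := by
        rw [integral_mul_const, integral_mul_const, ρ.integral_normed, one_mul]

theorem hasFDerivAt_normed_convolution [FiniteDimensional ℝ F] (ρ : ContDiffBump (0 : E))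
    (hg : LipschitzWith L g) (x : E) :
    HasFDerivAt (ρ.normed μ ⋆[ContinuousLinearMap.lsmul ℝ ℝ, μ] g)
      ((ρ.normed μ ⋆[ContinuousLinearMap.lsmul ℝ ℝ, μ] fderiv ℝ g) x) x := by
  have : CompleteSpace F := FiniteDimensional.complete ℝ F
  have hdiff : ∀ᵐ t ∂μ, DifferentiableAt ℝ g (x - t) :=
    (Measure.measurePreserving_sub_left μ x).quasiMeasurePreserving.ae hg.ae_differentiableAt
  refine (hasFDerivAt_integral_of_dominated_loc_of_lip (s := Set.univ)
    (bound := fun t => ρ.normed μ t * L) univ_mem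
    (Eventually.of_forall fun y => (integrable_normed_smul_comp_sub ρ hg.continuous y).1)
    (integrable_normed_smul_comp_sub ρ hg.continuous x) ?_
    (Eventually.of_forall fun t => (lipschitzWith_const_smul_comp_sub hg _ t).lipschitzOnWith)
    (ρ.integrable_normed.mul_const _) ?_).2
  · exact ρ.continuous_normed.aestronglyMeasurable.smul
      ((measurable_fderiv ℝ g).comp (measurable_const.sub measurable_id)).aestronglyMeasurable
  · filter_upwards [hdiff] with t ht
    exact (ht.hasFDerivAt.comp x ((hasFDerivAt_id x).sub_const t)).const_smul (ρ.normed μ t)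

theorem ae_tendsto_fderiv_normed_convolution [FiniteDimensional ℝ F] (hg : LipschitzWith L g)
    {ι : Type*} {l : Filter ι} {ρ : ι → ContDiffBump (0 : E)} {K : ℝ}
    (hρ : Tendsto (fun j => (ρ j).rOut) l (𝓝 0)) (hK : ∀ᶠ j in l, (ρ j).rOut ≤ K * (ρ j).rIn) :
    ∀ᵐ x ∂μ, Tendsto
      (fun j => fderiv ℝ ((ρ j).normed μ ⋆[ContinuousLinearMap.lsmul ℝ ℝ, μ] g) x) l
      (𝓝 (fderiv ℝ g x)) := by
  have : CompleteSpace F := FiniteDimensional.complete ℝ F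
  have hloc : LocallyIntegrable (fderiv ℝ g) μ :=
    (memLp_top_of_bound (measurable_fderiv ℝ g).aestronglyMeasurable L
      (Eventually.of_forall fun x => norm_fderiv_le_of_lipschitz ℝ hg)).locallyIntegrable le_top
  simpa only [(hasFDerivAt_normed_convolution _ hg _).fderiv] using
    ContDiffBump.ae_convolution_tendsto_right_of_locallyIntegrable hρ hK hloc

theorem support_normed_convolution_subset (ρ : ContDiffBump (0 : E)) :
    Function.support (ρ.normed μ ⋆[ContinuousLinearMap.lsmul ℝ ℝ, μ] g) ⊆
      Metric.cthickening ρ.rOut (tsupport g) := by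
  refine (support_convolution_subset_swap _).trans ?_
  rw [ρ.support_normed_eq]
  rintro _ ⟨y, hy, z, hz, rfl⟩
  refine Metric.mem_cthickening_of_dist_le _ y _ _ (subset_tsupport g hy) ?_
  simpa using (mem_ball_zero_iff.1 hz).le

theorem exists_contDiff_approx_of_lipschitzWith [FiniteDimensional ℝ F] (hg : LipschitzWith L g)
    (hgc : HasCompactSupport g) {Ω : Set E} (hΩ : IsOpen Ω) (hgΩ : tsupport g ⊆ Ω) :
    ∃ f : ℕ → E → F, ∃ K : Set E, IsCompact K ∧ K ⊆ Ω ∧ (∀ j, Function.support (f j) ⊆ K) ∧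
      (∀ j, ContDiff ℝ ∞ (f j)) ∧ (∀ j, LipschitzWith L (f j)) ∧
      (∀ x, Tendsto (fun j => f j x) atTop (𝓝 (g x))) ∧
      ∀ᵐ x ∂μ, Tendsto (fun j => fderiv ℝ (f j) x) atTop (𝓝 (fderiv ℝ g x)) := by
  have : CompleteSpace F := FiniteDimensional.complete ℝ F
  obtain ⟨δ, hδ, hδΩ⟩ := hgc.isCompact.exists_cthickening_subset_open hΩ hgΩ
  let ρ : ℕ → ContDiffBump (0 : E) := fun j =>
    ⟨δ / (j + 1) / 2, δ / (j + 1), by positivity, half_lt_self (by positivity)⟩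
  have hρ : Tendsto (fun j => (ρ j).rOut) atTop (𝓝 0) :=
    tendsto_const_div_atTop_nhds_zero_nat δ |>.comp (tendsto_add_atTop_nat 1) |>.congr (by simp [ρ])
  have hρδ : ∀ j, (ρ j).rOut ≤ δ := fun j => div_le_self hδ.le (by simp)
  refine ⟨fun j => (ρ j).normed μ ⋆[ContinuousLinearMap.lsmul ℝ ℝ, μ] g,
    Metric.cthickening δ (tsupport g), hgc.isCompact.cthickening, hδΩ,
    fun j => (support_normed_convolution_subset _).trans (Metric.cthickening_mono (hρδ j) _),
    fun j => ?_, fun j => lipschitzWith_normed_convolution (ρ j) hg, fun x => ?_,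
    ae_tendsto_fderiv_normed_convolution hg hρ (K := 2)
      (Eventually.of_forall fun j => (mul_div_cancel₀ _ two_ne_zero).ge)⟩
  · exact (ρ j).hasCompactSupport_normed.contDiff_convolution_left _ (ρ j).contDiff_normed
      hg.continuous.locallyIntegrable
  · exact ContDiffBump.convolution_tendsto_right_of_continuous hρ hg.continuous x

end Mollification

section LipschitzFunctions

theorem lipschitzWith_mul_of_norm_le {α : Type*} [PseudoMetricSpace α] {f g : α → ℝ}
    {C D M N : NNReal} (hf : LipschitzWith C f) (hg : LipschitzWith D g) (hfM : ∀ x, ‖f x‖ ≤ M)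
    (hgN : ∀ x, ‖g x‖ ≤ N) : LipschitzWith (M * D + N * C) fun x => f x * g x := by
  refine LipschitzWith.of_dist_le_mul fun x y => ?_
  calc dist (f x * g x) (f y * g y) = ‖f x * (g x - g y) + g y * (f x - f y)‖ := by
        rw [Real.dist_eq, Real.norm_eq_abs]; ring_nf
    _ ≤ ‖f x‖ * ‖g x - g y‖ + ‖g y‖ * ‖f x - f y‖ :=
        (norm_add_le _ _).trans_eq (by rw [norm_mul, norm_mul])
    _ ≤ M * (D * dist x y) + N * (C * dist x y) := by
        gcongr
        exacts [hfM x, hg.dist_le_mul x y, hgN y, hf.dist_le_mul x y]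
    _ = ↑(M * D + N * C) * dist x y := by push_cast; ring

variable {E F : Type*} [NormedAddCommGroup E] [NormedSpace ℝ E] [NormedAddCommGroup F]

theorem norm_le_indicator_of_support_subset {α : Type*} {f : α → F} {K : Set α} {M : ℝ}
    (hf : Function.support f ⊆ K) (hM : ∀ x, ‖f x‖ ≤ M) (x : α) :
    ‖f x‖ ≤ K.indicator (fun _ => M) x := by
  by_cases hx : x ∈ K
  · simpa only [Set.indicator_of_mem hx] using hM x
  · rw [Function.notMem_support.1 fun h => hx (hf h), norm_zero, Set.indicator_of_notMem hx]

theorem exists_norm_le_of_lipschitzWith_of_support_subset {α : Type*} [PseudoMetricSpace α]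
    [NoncompactSpace α] (L : NNReal) {K : Set α} (hK : IsCompact K) :
    ∃ M : ℝ, ∀ f : α → F, LipschitzWith L f → Function.support f ⊆ K → ∀ x, ‖f x‖ ≤ M := by
  obtain ⟨z, hz⟩ := (Set.ne_univ_iff_exists_notMem K).1 hK.ne_univ
  obtain ⟨R, hR⟩ := hK.isBounded.subset_closedBall z
  refine ⟨L * max R 0, fun f hf hfK x => ?_⟩
  by_cases hx : x ∈ K
  · calc ‖f x‖ = dist (f x) (f z) := by
          rw [Function.notMem_support.1 fun h => hz (hfK h), dist_zero_right]
      _ ≤ L * dist x z := hf.dist_le_mul x z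
      _ ≤ L * max R 0 := by
          gcongr
          exact (Metric.mem_closedBall.1 (hR hx)).trans (le_max_left R 0)
  · rw [Function.notMem_support.1 fun h => hx (hfK h), norm_zero]
    positivity

theorem exists_mem_segment_mem_frontier {Ω : Set E} {x y : E} (hx : x ∈ Ω) (hy : y ∉ Ω) :
    ∃ z ∈ segment ℝ x y, z ∈ frontier Ω := by
  by_contra! hdisj
  have hcover : segment ℝ x y ⊆ interior Ω ∪ interior Ωᶜ := fun z hz => by
    by_contra hz'
    rw [interior_compl] at hz'
    exact hdisj z hz ⟨not_not.1 fun h => hz' (Or.inr h), fun h => hz' (Or.inl h)⟩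
  have hsub := (convex_segment x y).isPreconnected.subset_left_of_subset_union isOpen_interior
    isOpen_interior (disjoint_compl_right.mono interior_subset interior_subset) hcover
    ⟨x, left_mem_segment ℝ x y, (hcover (left_mem_segment ℝ x y)).resolve_right
      fun h => interior_subset h hx⟩
  exact hy (interior_subset (hsub (right_mem_segment ℝ x y)))

theorem lipschitzWith_indicator_of_eq_zero_on_frontier {g : E → F} {L : NNReal}
    (hg : LipschitzWith L g) {Ω : Set E} (hgΩ : ∀ x ∈ frontier Ω, g x = 0) :
    LipschitzWith L (Ω.indicator g) := by
  have hcross : ∀ x ∈ Ω, ∀ y ∉ Ω, ‖g x‖ ≤ L * dist x y := fun x hx y hy => by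
    obtain ⟨z, hz, hzΩ⟩ := exists_mem_segment_mem_frontier hx hy
    calc ‖g x‖ = dist (g x) (g z) := by rw [hgΩ z hzΩ, dist_zero_right]
      _ ≤ L * dist x z := hg.dist_le_mul x z
      _ ≤ L * dist x y := by
          gcongr
          linarith [dist_add_dist_of_mem_segment hz, dist_nonneg (x := z) (y := y)]
  refine LipschitzWith.of_dist_le_mul fun x y => ?_
  by_cases hx : x ∈ Ω <;> by_cases hy : y ∈ Ω
  · simpa only [Set.indicator_of_mem, hx, hy] using hg.dist_le_mul x y
  · simpa only [Set.indicator_of_mem hx, Set.indicator_of_notMem hy, dist_zero_right]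
      using hcross x hx y hy
  · simpa only [Set.indicator_of_mem hy, Set.indicator_of_notMem hx, dist_zero_left, dist_comm x]
      using hcross y hy x hx
  · simpa only [Set.indicator_of_notMem, hx, hy, dist_self, not_false_eq_true] using by positivity

theorem exists_lipschitzWith_cutoff [FiniteDimensional ℝ E] :
    ∃ (χ : ℕ → E → ℝ) (C : NNReal), (∀ j, HasCompactSupport (χ j)) ∧ (∀ j x, ‖χ j x‖ ≤ 1) ∧
      (∀ j, LipschitzWith C (χ j)) ∧ ∀ x, ∀ᶠ j in atTop, χ j =ᶠ[𝓝 x] fun _ => 1 := by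
  let η : ContDiffBump (0 : E) := ⟨1, 2, one_pos, one_lt_two⟩
  obtain ⟨C, hC⟩ := η.contDiff.lipschitzWith_of_hasCompactSupport (n := 1) η.hasCompactSupport
    one_ne_zero
  have hpos : ∀ j : ℕ, (0 : ℝ) < j + 1 := fun j => by positivity
  refine ⟨fun j x => η ((j + 1 : ℝ)⁻¹ • x), C,
    fun j => η.hasCompactSupport.comp_smul (inv_pos.2 (hpos j)).ne',
    fun j x => (Real.norm_of_nonneg η.nonneg).trans_le η.le_one, fun j => ?_, fun x => ?_⟩
  · refine LipschitzWith.of_dist_le_mul fun x y => (hC.dist_le_mul _ _).trans ?_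
    rw [dist_smul₀, Real.norm_of_nonneg (inv_pos.2 (hpos j)).le]
    gcongr
    exact mul_le_of_le_one_left dist_nonneg (inv_le_one_of_one_le₀ (by simp))
  · filter_upwards [(tendsto_atTop_add_const_right atTop (1 : ℝ)
      tendsto_natCast_atTop_atTop).eventually_gt_atTop ‖x‖] with j hj
    filter_upwards [continuous_norm.continuousAt.eventually_lt continuousAt_const hj] with y hy
    refine η.one_of_mem_closedBall (mem_closedBall_zero_iff.2 ?_)
    rw [norm_smul, Real.norm_of_nonneg (inv_pos.2 (hpos j)).le]
    exact (inv_mul_le_one₀ (hpos j)).2 hy.le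

theorem exists_lipschitzWith_cutoff_of_disjoint_tsupport_frontier [FiniteDimensional ℝ E]
    {Ω : Set E} (hΩ : IsOpen Ω) {f : E → ℝ} {L N : NNReal} (hf : LipschitzWith L f)
    (hfN : ∀ x, ‖f x‖ ≤ N) (hfΩ : Disjoint (tsupport f) (frontier Ω)) :
    ∃ (g : ℕ → E → ℝ) (C : NNReal), (∀ j, LipschitzWith C (g j)) ∧ (∀ j, HasCompactSupport (g j)) ∧
      (∀ j, tsupport (g j) ⊆ Ω) ∧ (∀ j x, ‖g j x‖ ≤ N) ∧
      ∀ x ∈ Ω, ∀ᶠ j in atTop, g j =ᶠ[𝓝 x] f := by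
  obtain ⟨χ, C, hχc, hχ1, hχL, hχ⟩ := exists_lipschitzWith_cutoff (E := E)
  refine ⟨fun j => Ω.indicator fun x => χ j x * f x, 1 * L + N * C, fun j => ?_, fun j => ?_,
    fun j => ?_, fun j x => ?_, fun x hx => ?_⟩
  · refine lipschitzWith_indicator_of_eq_zero_on_frontier
      (lipschitzWith_mul_of_norm_le (hχL j) hf (by simpa using hχ1 j) hfN) fun x hx => ?_
    rw [image_eq_zero_of_notMem_tsupport fun h => hfΩ.notMem_of_mem_left h hx, mul_zero]
  · refine (hχc j).mono ?_
    rw [Set.support_indicator, Function.support_mul]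
    exact fun x hx => hx.2.1
  · have hsub : Function.support (Ω.indicator fun x => χ j x * f x) ⊆ closure Ω ∩ tsupport f := by
      rw [Set.support_indicator, Function.support_mul]
      exact fun x hx => ⟨subset_closure hx.1, subset_tsupport f hx.2.2⟩
    intro x hx
    obtain ⟨hxΩ, hxf⟩ := closure_minimal hsub (isClosed_closure.inter (isClosed_tsupport f)) hx
    by_contra hxΩ'
    exact hfΩ.notMem_of_mem_left hxf (hΩ.frontier_eq ▸ ⟨hxΩ, hxΩ'⟩)
  · refine (norm_indicator_le_norm_self _ x).trans ?_
    rw [norm_mul]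
    exact (mul_le_of_le_one_left (norm_nonneg _) (hχ1 j x)).trans (hfN x)
  · filter_upwards [hχ x] with j hj
    filter_upwards [hj, hΩ.mem_nhds hx] with y hy hyΩ
    rw [Set.indicator_of_mem hyΩ, hy, one_mul]

end LipschitzFunctions

section Gradient

variable {E : Type*} [NormedAddCommGroup E] [InnerProductSpace ℝ E]

theorem norm_gradient_eq_norm_fderiv [CompleteSpace E] (f : E → ℝ) (x : E) :
    ‖∇ f x‖ = ‖fderiv ℝ f x‖ := by
  rw [← toDual_gradient, LinearIsometryEquiv.norm_map]

theorem norm_gradient_le_of_lipschitzWith [CompleteSpace E] {f : E → ℝ} {L : NNReal}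
    (hf : LipschitzWith L f) (x : E) : ‖∇ f x‖ ≤ L :=
  (norm_gradient_eq_norm_fderiv f x).trans_le (norm_fderiv_le_of_lipschitz ℝ hf)

theorem support_gradient_subset_tsupport [CompleteSpace E] (f : E → ℝ) :
    Function.support (∇ f) ⊆ tsupport f :=
  fun x hx => support_fderiv_subset ℝ fun hx0 => hx (by
    rw [← norm_eq_zero, norm_gradient_eq_norm_fderiv, hx0, norm_zero])

theorem gradient_comp [CompleteSpace E] {S : ℝ → ℝ} {f : E → ℝ} {x : E}
    (hS : DifferentiableAt ℝ S (f x)) (hf : DifferentiableAt ℝ f x) :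
    ∇ (S ∘ f) x = deriv S (f x) • ∇ f x := by
  refine ext_inner_right ℝ fun v => ?_
  rw [inner_gradient_left, real_inner_smul_left, inner_gradient_left,
    (hS.hasDerivAt.comp_hasFDerivAt x hf.hasFDerivAt).fderiv, smul_apply, smul_eq_mul]

variable [FiniteDimensional ℝ E] [MeasurableSpace E] [BorelSpace E] {μ : Measure E}

theorem measurable_gradient (f : E → ℝ) : Measurable (∇ f) :=
  (InnerProductSpace.toDual ℝ E).symm.continuous.measurable.comp (measurable_fderiv ℝ f)

theorem locallyIntegrable_gradient_of_lipschitzWith [IsLocallyFiniteMeasure μ] {f : E → ℝ}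
    {L : NNReal} (hf : LipschitzWith L f) : LocallyIntegrable (∇ f) μ :=
  (memLp_top_of_bound (measurable_gradient f).aestronglyMeasurable L
    (Eventually.of_forall (norm_gradient_le_of_lipschitzWith hf))).locallyIntegrable le_top

theorem memLp_gradient_of_lipschitzWith [IsFiniteMeasureOnCompacts μ] {p : ENNReal} {f : E → ℝ}
    {L : NNReal} (hf : LipschitzWith L f) (hfc : HasCompactSupport f) : MemLp (∇ f) p μ :=
  (memLp_indicator_const p hfc.isCompact.measurableSet (L : ℝ)
    (Or.inr hfc.isCompact.measure_ne_top)).mono' (measurable_gradient f).aestronglyMeasurable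
    (Eventually.of_forall (norm_le_indicator_of_support_subset
      (support_gradient_subset_tsupport f) (norm_gradient_le_of_lipschitzWith hf)))

theorem integral_smul_gradient_of_lipschitzWith [μ.IsAddHaarMeasure] {W φ : E → ℝ} {L C : NNReal}
    (hW : LipschitzWith L W) (hφ : LipschitzWith C φ) (hφc : HasCompactSupport φ) :
    ∫ x, W x • ∇ φ x ∂μ = -∫ x, φ x • ∇ W x ∂μ := by
  have hWφ : Integrable (fun x => W x • ∇ φ x) μ :=
    (integrableOn_iff_integrable_of_support_subset
      ((Function.support_smul_subset_right W (∇ φ)).trans (support_gradient_subset_tsupport φ))).1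
      (((locallyIntegrable_gradient_of_lipschitzWith hφ).integrableOn_isCompact
        hφc.isCompact).continuousOn_smul hW.continuous.continuousOn hφc.isCompact)
  have hφW : Integrable (fun x => φ x • ∇ W x) μ :=
    (locallyIntegrable_gradient_of_lipschitzWith hW).integrable_smul_left_of_hasCompactSupport
      hφ.continuous hφc
  refine ext_inner_left ℝ fun v => ?_
  rw [inner_neg_right, ← integral_inner hWφ, ← integral_inner hφW, ← integral_neg]
  calc ∫ x, inner ℝ v (W x • ∇ φ x) ∂μ = -∫ x, lineDeriv ℝ φ x (-v) * W x ∂μ := by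
        rw [← integral_neg]
        refine integral_congr_ae ?_
        filter_upwards [hφ.ae_differentiableAt] with x hx
        rw [real_inner_smul_right, inner_gradient_right, hx.lineDeriv_eq_fderiv, map_neg]
        simp only [conj_trivial]
        ring
    _ = -∫ x, lineDeriv ℝ W x v * φ x ∂μ := by rw [hW.integral_lineDeriv_mul_eq hφ hφc]
    _ = ∫ x, -inner ℝ v (φ x • ∇ W x) ∂μ := by
        rw [← integral_neg]
        refine integral_congr_ae ?_
        filter_upwards [hW.ae_differentiableAt] with x hx
        rw [real_inner_smul_right, inner_gradient_right, hx.lineDeriv_eq_fderiv]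
        simp only [conj_trivial]
        ring

end Gradient

section WeakGradient

variable {Ω : Set Plane} {φ v w : Plane → ℝ} {G H : Plane → Plane}

theorem IsTestFunction.continuous_gradient (hφ : IsTestFunction Ω φ) : Continuous (∇ φ) :=
  (InnerProductSpace.toDual ℝ Plane).symm.continuous.comp (hφ.1.continuous_fderiv (by simp))

theorem IsTestFunction.hasCompactSupport_gradient (hφ : IsTestFunction Ω φ) :
    HasCompactSupport (∇ φ) :=
  hφ.2.1.mono' (support_gradient_subset_tsupport φ)

theorem IsTestFunction.setIntegral_smul (hφ : IsTestFunction Ω φ) (G : Plane → Plane) :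
    ∫ x in Ω, φ x • G x = ∫ x, φ x • G x :=
  setIntegral_eq_integral_of_forall_compl_eq_zero fun x hx => by
    rw [image_eq_zero_of_notMem_tsupport fun h => hx (hφ.2.2 h), zero_smul]

theorem IsTestFunction.setIntegral_smul_gradient (hφ : IsTestFunction Ω φ) (v : Plane → ℝ) :
    ∫ x in Ω, v x • ∇ φ x = ∫ x, v x • ∇ φ x :=
  setIntegral_eq_integral_of_forall_compl_eq_zero fun x hx => by
    rw [Function.notMem_support.1 fun h => hx (hφ.2.2 (support_gradient_subset_tsupport φ h)),
      smul_zero]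

theorem IsTestFunction.integrable_smul (hφ : IsTestFunction Ω φ)
    (hG : LocallyIntegrableOn G Ω volume) : Integrable (fun x => φ x • G x) :=
  (integrableOn_iff_integrable_of_support_subset
    ((Function.support_smul_subset_left φ G).trans (subset_tsupport φ))).1
    ((hG.integrableOn_compact_subset hφ.2.2 hφ.2.1).continuousOn_smul
      hφ.1.continuous.continuousOn hφ.2.1)

theorem IsTestFunction.integrable_smul_gradient (hφ : IsTestFunction Ω φ)
    (hv : LocallyIntegrableOn v Ω volume) : Integrable (fun x => v x • ∇ φ x) :=
  (integrableOn_iff_integrable_of_support_subset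
    ((Function.support_smul_subset_right v (∇ φ)).trans (support_gradient_subset_tsupport φ))).1
    ((hv.integrableOn_compact_subset hφ.2.2 hφ.2.1).smul_continuousOn
      hφ.continuous_gradient.continuousOn hφ.2.1)

theorem IsTestFunction.eLpNorm_two_le (hφ : IsTestFunction Ω φ) :
    eLpNorm φ 2 (volume.restrict Ω) ≤
      eLpNormLESNormFDerivOneConst (volume : Measure Plane) 2 *
        eLpNorm (∇ φ) 1 (volume.restrict Ω) := by
  have hconj : NNReal.HolderConjugate (Module.finrank ℝ Plane) 2 := by
    rw [finrank_euclideanSpace_fin]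
    exact_mod_cast NNReal.HolderConjugate.two_two
  have hfderiv : eLpNorm (fderiv ℝ φ) 1 volume = eLpNorm (∇ φ) 1 (volume.restrict Ω) := by
    rw [eLpNorm_restrict_eq_of_support_subset
      ((support_gradient_subset_tsupport φ).trans hφ.2.2)]
    exact eLpNorm_congr_norm_ae
      (Eventually.of_forall fun x => (norm_gradient_eq_norm_fderiv φ x).symm)
  rw [← hfderiv]
  exact (eLpNorm_mono_measure _ Measure.restrict_le_self).trans
    (eLpNorm_le_eLpNorm_fderiv_one volume (hφ.1.of_le (by exact_mod_cast le_top)) hφ.2.1 hconj)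

theorem HasWeakGradient.ae_eq (hΩ : IsOpen Ω) (hG : HasWeakGradient Ω v G)
    (hH : HasWeakGradient Ω v H) : G =ᵐ[volume.restrict Ω] H := by
  have hzero := hΩ.ae_eq_zero_of_integral_contDiff_smul_eq_zero (hG.2.1.sub hH.2.1)
    fun φ hφ hφc hφΩ => by
      have hφt : IsTestFunction Ω φ := ⟨hφ, hφc, hφΩ⟩
      rw [← hφt.setIntegral_smul]
      simp only [Pi.sub_apply, smul_sub]
      rw [integral_sub (hφt.integrable_smul hG.2.1).integrableOn
        (hφt.integrable_smul hH.2.1).integrableOn, sub_eq_zero, ← neg_inj, ← hG.2.2 φ hφt,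
        ← hH.2.2 φ hφt]
  filter_upwards [ae_restrict_of_ae hzero, ae_restrict_mem hΩ.measurableSet] with x hx hxΩ
  exact sub_eq_zero.1 (hx hxΩ)

theorem HasWeakGradient.sub (hv : HasWeakGradient Ω v G) (hw : HasWeakGradient Ω w H) :
    HasWeakGradient Ω (fun x => v x - w x) (G - H) := by
  refine ⟨hv.1.sub hw.1, hv.2.1.sub hw.2.1, fun φ hφ => ?_⟩
  simp only [Pi.sub_apply, sub_smul, smul_sub]
  rw [integral_sub (hφ.integrable_smul_gradient hv.1).integrableOn
      (hφ.integrable_smul_gradient hw.1).integrableOn,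
    integral_sub (hφ.integrable_smul hv.2.1).integrableOn
      (hφ.integrable_smul hw.2.1).integrableOn, hv.2.2 φ hφ, hw.2.2 φ hφ, neg_sub_neg, neg_sub]

theorem HasWeakGradient.congr (hΩ : MeasurableSet Ω) (hv : HasWeakGradient Ω v G)
    (hvw : Set.EqOn v w Ω) (hw : LocallyIntegrableOn w Ω volume) : HasWeakGradient Ω w G :=
  ⟨hw, hv.2.1, fun φ hφ => by
    rw [← hv.2.2 φ hφ]
    exact setIntegral_congr_fun hΩ fun x hx => by simp only [hvw hx]⟩

theorem hasWeakGradient_of_lipschitzWith {L : NNReal} (hv : LipschitzWith L v) :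
    HasWeakGradient Ω v (∇ v) := by
  refine ⟨hv.continuous.locallyIntegrable.locallyIntegrableOn _,
    (locallyIntegrable_gradient_of_lipschitzWith hv).locallyIntegrableOn _, fun φ hφ => ?_⟩
  obtain ⟨C, hC⟩ := hφ.1.lipschitzWith_of_hasCompactSupport hφ.2.1 (by simp)
  rw [hφ.setIntegral_smul, hφ.setIntegral_smul_gradient]
  exact integral_smul_gradient_of_lipschitzWith hv hC hφ.2.1

end WeakGradient

section SobolevZero

/-- `g ∈ W₀^{1,p}(Ω)` with gradient `F`: the pair `(g, F)` is a limit in `L^p(Ω)` of pairs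
`(φ, ∇ φ)` with `φ` a test function. The gradient is carried along as data, so that `g` need not
be differentiable. -/
structure MemW1pZero (p : ENNReal) (Ω : Set Plane) (g : Plane → ℝ) (F : Plane → Plane) : Prop where
  memLp : MemLp g p (volume.restrict Ω)
  memLp_gradient : MemLp F p (volume.restrict Ω)
  exists_eLpNorm_lt : ∀ ε : ENNReal, 0 < ε → ∃ φ, IsTestFunction Ω φ ∧
    eLpNorm (φ - g) p (volume.restrict Ω) < ε ∧ eLpNorm (∇ φ - F) p (volume.restrict Ω) < ε

/-- `A` is weakly divergence-free in `Ω`: it is orthogonal to the gradients of test functions. -/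
def IsWeaklyDivFree (Ω : Set Plane) (A : Plane → Plane) : Prop :=
  ∀ φ : Plane → ℝ, IsTestFunction Ω φ → ∫ x in Ω, inner ℝ (A x) (∇ φ x) = 0

variable {p q : ENNReal} {Ω : Set Plane} {g : Plane → ℝ} {F : Plane → Plane}

theorem IsTestFunction.memLp_gradient {φ : Plane → ℝ} (hφ : IsTestFunction Ω φ) :
    MemLp (∇ φ) p (volume.restrict Ω) :=
  (hφ.continuous_gradient.memLp_of_hasCompactSupport hφ.hasCompactSupport_gradient).restrict Ω

theorem MemW1pZero.exists_seq_tendsto (h : MemW1pZero p Ω g F) :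
    ∃ φ : ℕ → Plane → ℝ, (∀ n, IsTestFunction Ω (φ n)) ∧
      Tendsto (fun n => eLpNorm (φ n - g) p (volume.restrict Ω)) atTop (𝓝 0) ∧
      Tendsto (fun n => eLpNorm (∇ (φ n) - F) p (volume.restrict Ω)) atTop (𝓝 0) := by
  choose φ hφ hφg hφF using fun n : ℕ =>
    h.exists_eLpNorm_lt (n : ENNReal)⁻¹ (ENNReal.inv_pos.2 (ENNReal.natCast_ne_top n))
  have squeeze : ∀ {a : ℕ → ENNReal}, (∀ n : ℕ, a n < (n : ENNReal)⁻¹) → Tendsto a atTop (𝓝 0) :=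
    fun ha => tendsto_of_tendsto_of_tendsto_of_le_of_le tendsto_const_nhds
      ENNReal.tendsto_inv_nat_nhds_zero (fun _ => zero_le) fun n => (ha n).le
  exact ⟨φ, hφ, squeeze hφg, squeeze hφF⟩

theorem MemW1pZero.of_tendsto (hp : 1 ≤ p) {gs : ℕ → Plane → ℝ} {Fs : ℕ → Plane → Plane}
    (h : ∀ n, MemW1pZero p Ω (gs n) (Fs n)) (hg : MemLp g p (volume.restrict Ω))
    (hF : MemLp F p (volume.restrict Ω))
    (hgs : Tendsto (fun n => eLpNorm (gs n - g) p (volume.restrict Ω)) atTop (𝓝 0))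
    (hFs : Tendsto (fun n => eLpNorm (Fs n - F) p (volume.restrict Ω)) atTop (𝓝 0)) :
    MemW1pZero p Ω g F := by
  refine ⟨hg, hF, fun ε hε => ?_⟩
  have hε2 : 0 < ε / 2 := ENNReal.half_pos hε.ne'
  obtain ⟨n, hgn, hFn⟩ :=
    ((hgs.eventually_lt_const hε2).and (hFs.eventually_lt_const hε2)).exists
  obtain ⟨φ, hφ, hφg, hφF⟩ := (h n).exists_eLpNorm_lt (ε / 2) hε2
  refine ⟨φ, hφ, ?_, ?_⟩
  · rw [← sub_add_sub_cancel φ (gs n) g, ← ENNReal.add_halves ε]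
    exact (eLpNorm_add_le (hφ.1.continuous.aestronglyMeasurable.sub (h n).memLp.1)
      ((h n).memLp.1.sub hg.1) hp).trans_lt (ENNReal.add_lt_add hφg hgn)
  · rw [← sub_add_sub_cancel (∇ φ) (Fs n) F, ← ENNReal.add_halves ε]
    exact (eLpNorm_add_le (hφ.continuous_gradient.aestronglyMeasurable.sub (h n).memLp_gradient.1)
      ((h n).memLp_gradient.1.sub hF.1) hp).trans_lt (ENNReal.add_lt_add hφF hFn)

theorem memW1pZero_of_lipschitzWith (hp0 : p ≠ 0) (hp : p ≠ ⊤) (hΩ : IsOpen Ω) {L : NNReal}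
    (hg : LipschitzWith L g) (hgc : HasCompactSupport g) (hgΩ : tsupport g ⊆ Ω) :
    MemW1pZero p Ω g (∇ g) := by
  obtain ⟨φ, K, hK, hKΩ, hφK, hφ, hφL, hφg, hφ'⟩ :=
    exists_contDiff_approx_of_lipschitzWith (μ := volume) hg hgc hΩ hgΩ
  have hφt : ∀ j, tsupport (φ j) ⊆ K := fun j => closure_minimal (hφK j) hK.isClosed
  have hφΩ : ∀ j, IsTestFunction Ω (φ j) := fun j =>
    ⟨hφ j, HasCompactSupport.of_support_subset_isCompact hK (hφK j), (hφt j).trans hKΩ⟩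
  have hgrad : ∀ᵐ x, Tendsto (fun j => ∇ (φ j) x) atTop (𝓝 (∇ g x)) := by
    filter_upwards [hφ'] with x hx
    exact ((InnerProductSpace.toDual ℝ Plane).symm.continuous.tendsto _).comp hx
  obtain ⟨M, hM⟩ := exists_norm_le_of_lipschitzWith_of_support_subset (F := ℝ) L hK
  have hconst : ∀ C : ℝ, MemLp (K.indicator fun _ => C) p (volume.restrict Ω) := fun C =>
    memLp_indicator_const p hK.measurableSet C
      (Or.inr (ne_top_of_le_ne_top hK.measure_ne_top (Measure.restrict_apply_le _ _)))
  have hφlim := tendsto_eLpNorm_sub_of_dominated hp0 hp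
    (fun j => (hφ j).continuous.aestronglyMeasurable) (hconst M)
    (fun j => Eventually.of_forall
      (norm_le_indicator_of_support_subset (hφK j) (hM (φ j) (hφL j) (hφK j))))
    (Eventually.of_forall hφg)
  have hgradlim := tendsto_eLpNorm_sub_of_dominated hp0 hp
    (fun j => (hφΩ j).continuous_gradient.aestronglyMeasurable) (hconst L)
    (fun j => Eventually.of_forall (norm_le_indicator_of_support_subset
      ((support_gradient_subset_tsupport _).trans (hφt j))
      (norm_gradient_le_of_lipschitzWith (hφL j)))) (ae_restrict_of_ae hgrad)
  refine ⟨(hg.continuous.memLp_of_hasCompactSupport hgc).restrict Ω,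
    (memLp_gradient_of_lipschitzWith hg hgc).restrict Ω, fun ε hε => ?_⟩
  obtain ⟨j, hj, hj'⟩ :=
    ((hφlim.eventually_lt_const hε).and (hgradlim.eventually_lt_const hε)).exists
  exact ⟨φ j, hφΩ j, hj, hj'⟩

theorem MemW1pZero.integral_inner_eq_zero [ENNReal.HolderTriple q p 1]
    (h : MemW1pZero p Ω g F) {A : Plane → Plane} (hA : MemLp A q (volume.restrict Ω))
    (hdiv : IsWeaklyDivFree Ω A) : ∫ x in Ω, inner ℝ (A x) (F x) = 0 := by
  obtain ⟨φ, hφ, -, hφF⟩ := h.exists_seq_tendsto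
  have hlim := tendsto_integral_inner hA (fun n => (hφ n).memLp_gradient) h.memLp_gradient hφF
  simp only [fun n => hdiv _ (hφ n)] at hlim
  exact tendsto_nhds_unique hlim tendsto_const_nhds

theorem MemW1pZero.ae_eq_zero (hp : 1 ≤ p) (hΩ : volume Ω < ⊤) (h : MemW1pZero p Ω g F)
    (hF : F =ᵐ[volume.restrict Ω] 0) : g =ᵐ[volume.restrict Ω] 0 := by
  have : IsFiniteMeasure (volume.restrict Ω) := ⟨by simpa using hΩ⟩
  obtain ⟨φ, hφ, hφg, hφF⟩ := h.exists_seq_tendsto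
  have hgrad : Tendsto (fun n => eLpNorm (∇ (φ n)) 1 (volume.restrict Ω)) atTop (𝓝 0) := by
    refine tendsto_eLpNorm_zero_of_exponent_le one_ne_zero hp
      (fun n => (hφ n).continuous_gradient.aestronglyMeasurable) (hφF.congr fun n => ?_)
    exact eLpNorm_congr_ae (by simpa using (EventuallyEq.refl _ (∇ (φ n))).sub hF)
  have hsobolev : Tendsto (fun n => eLpNorm (φ n) 2 (volume.restrict Ω)) atTop (𝓝 0) := by
    have hbound := ENNReal.Tendsto.const_mul hgrad
      (Or.inr (ENNReal.coe_ne_top (r := eLpNormLESNormFDerivOneConst (volume : Measure Plane) 2)))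
    rw [mul_zero] at hbound
    exact tendsto_of_tendsto_of_tendsto_of_le_of_le tendsto_const_nhds hbound (fun _ => zero_le)
      fun n => (hφ n).eLpNorm_two_le
  have hmeas : ∀ n, AEStronglyMeasurable (φ n) (volume.restrict Ω) :=
    fun n => (hφ n).1.continuous.aestronglyMeasurable
  exact tendstoInMeasure_ae_unique
    (tendstoInMeasure_of_tendsto_eLpNorm (zero_lt_one.trans_le hp).ne' hmeas h.memLp.1 hφg)
    (tendstoInMeasure_of_tendsto_eLpNorm two_ne_zero hmeas aestronglyMeasurable_zero
      (by simpa only [sub_zero] using hsobolev))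

end SobolevZero

section Truncation

variable {Ω : Set Plane}

theorem memW1pZero_of_disjoint_tsupport_frontier {p : ENNReal} (hp1 : 1 ≤ p) (hp : p ≠ ⊤)
    (hΩ : IsOpen Ω) (hΩv : volume Ω < ⊤) {f : Plane → ℝ} {L N : NNReal} (hf : LipschitzWith L f)
    (hfN : ∀ x, ‖f x‖ ≤ N) (hfΩ : Disjoint (tsupport f) (frontier Ω)) :
    MemW1pZero p Ω f (∇ f) := by
  have : IsFiniteMeasure (volume.restrict Ω) := ⟨by simpa using hΩv⟩
  have hp0 : p ≠ 0 := (zero_lt_one.trans_le hp1).ne'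
  obtain ⟨g, C, hgL, hgc, hgΩ, hgN, hgf⟩ :=
    exists_lipschitzWith_cutoff_of_disjoint_tsupport_frontier hΩ hf hfN hfΩ
  have hlim : ∀ᵐ x ∂(volume.restrict Ω), ∀ᶠ j in atTop, g j =ᶠ[𝓝 x] f :=
    (ae_restrict_mem hΩ.measurableSet).mono hgf
  refine MemW1pZero.of_tendsto hp1
    (fun j => memW1pZero_of_lipschitzWith hp0 hp hΩ (hgL j) (hgc j) (hgΩ j))
    (MemLp.of_bound hf.continuous.aestronglyMeasurable N (Eventually.of_forall hfN))
    (MemLp.of_bound (measurable_gradient f).aestronglyMeasurable L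
      (Eventually.of_forall (norm_gradient_le_of_lipschitzWith hf))) ?_ ?_
  · refine tendsto_eLpNorm_sub_of_dominated hp0 hp
      (fun j => (hgL j).continuous.aestronglyMeasurable) (memLp_const (N : ℝ))
      (fun j => Eventually.of_forall (hgN j)) ?_
    filter_upwards [hlim] with x hx
    exact tendsto_const_nhds.congr' (hx.mono fun j hj => hj.eq_of_nhds.symm)
  · refine tendsto_eLpNorm_sub_of_dominated hp0 hp
      (fun j => (measurable_gradient (g j)).aestronglyMeasurable) (memLp_const (C : ℝ))
      (fun j => Eventually.of_forall (norm_gradient_le_of_lipschitzWith (hgL j))) ?_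
    filter_upwards [hlim] with x hx
    exact tendsto_const_nhds.congr' (hx.mono fun j hj => hj.gradient_eq.symm)

theorem SobolevBoundaryLE.exists_lipschitzWith_approx {p : ℝ} (hp : 0 < p) (hΩ : IsOpen Ω)
    {v : Plane → ℝ} {k : ℝ} (hv : SobolevBoundaryLE p Ω v k) {G : Plane → Plane}
    (hG : HasWeakGradient Ω v G) :
    ∃ W : ℕ → Plane → ℝ, (∀ n, ∃ L, LipschitzWith L (W n)) ∧
      (∀ n, ∀ x ∈ frontier Ω, W n x ≤ k) ∧
      (∀ᵐ x ∂(volume.restrict Ω), Tendsto (fun n => W n x) atTop (𝓝 (v x))) ∧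
      Tendsto (fun n => eLpNorm (∇ (W n) - G) (ENNReal.ofReal p) (volume.restrict Ω))
        atTop (𝓝 0) := by
  obtain ⟨w, H, hwL, hwk, hH, hw0, hH0⟩ := hv
  choose L hL using hwL
  choose W hWL hwW using fun n => (hL n).extend_real
  have hwWΩ : ∀ n, Set.EqOn (w n) (W n) Ω := fun n => (hwW n).mono subset_closure
  have hgrad : ∀ n, ∇ (W n) - G =ᵐ[volume.restrict Ω] -H n := fun n => by
    have hWG : HasWeakGradient Ω (W n) (G - H n) :=
      (hG.sub (hH n)).congr hΩ.measurableSet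
        (fun x hx => (sub_sub_cancel _ _).trans (hwWΩ n hx))
        ((hWL n).continuous.locallyIntegrable.locallyIntegrableOn _)
    filter_upwards [(hasWeakGradient_of_lipschitzWith (hWL n)).ae_eq hΩ hWG] with x hx
    rw [Pi.sub_apply, hx, Pi.sub_apply, Pi.neg_apply, sub_sub_cancel_left]
  have hmeas : TendstoInMeasure (volume.restrict Ω) (fun n x => v x - w n x) atTop 0 :=
    tendstoInMeasure_of_tendsto_eLpNorm (ENNReal.ofReal_pos.2 hp).ne'
      (fun n => (hH n).1.aestronglyMeasurable) aestronglyMeasurable_zero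
      (by simpa only [sub_zero] using hw0)
  obtain ⟨ns, hns, hae⟩ := hmeas.exists_seq_tendsto_ae
  refine ⟨fun j => W (ns j), fun j => ⟨_, hWL (ns j)⟩, fun j x hx => ?_, ?_, ?_⟩
  · exact (hwW (ns j) (frontier_subset_closure hx)).symm.trans_le (hwk _ x hx)
  · filter_upwards [hae, ae_restrict_mem hΩ.measurableSet] with x hx hxΩ
    have hlim := hx.const_sub (v x)
    simp only [sub_sub_cancel, Pi.zero_apply, sub_zero] at hlim
    exact hlim.congr fun j => hwWΩ _ hxΩ
  · refine (hH0.comp hns.tendsto_atTop).congr fun j => ?_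
    rw [Function.comp_apply, eLpNorm_congr_ae (hgrad (ns j)), eLpNorm_neg]

/-- `S` is a truncation at level `l`: a bounded `C¹` function with bounded derivative (hence
Lipschitz) that vanishes on `(-∞, l]`. Composing with `S` keeps a function in its Sobolev space
and discards its values up to `l`. -/
structure IsTruncation (S : ℝ → ℝ) (l : ℝ) : Prop where
  contDiff : ContDiff ℝ 1 S
  exists_lipschitzWith : ∃ M, LipschitzWith M S
  exists_norm_le : ∃ N : NNReal, ∀ t, ‖S t‖ ≤ N
  eq_zero_of_le : ∀ t ≤ l, S t = 0

theorem exists_lipschitzWith_smoothTransition : ∃ M, LipschitzWith M Real.smoothTransition := by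
  obtain ⟨M, hM⟩ := (Real.smoothTransition.contDiff (n := 1)).contDiffOn.exists_lipschitzOnWith
    one_ne_zero (convex_Icc (0 : ℝ) 1) isCompact_Icc
  refine ⟨M * 1, ?_⟩
  convert hM.to_restrict.comp (LipschitzWith.projIcc zero_le_one)
  exact funext fun t => Real.smoothTransition.projIcc.symm

theorem isTruncation_smoothTransition (l : ℝ) :
    IsTruncation (fun t => Real.smoothTransition (t - l)) l where
  contDiff := Real.smoothTransition.contDiff.comp (contDiff_id.sub contDiff_const)
  exists_lipschitzWith := by
    obtain ⟨M, hM⟩ := exists_lipschitzWith_smoothTransition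
    exact ⟨M, LipschitzWith.of_dist_le_mul fun t s => by
      simpa only [dist_sub_right] using hM.dist_le_mul (t - l) (s - l)⟩
  exists_norm_le := ⟨1, fun t =>
    (Real.norm_of_nonneg (Real.smoothTransition.nonneg _)).trans_le
      (Real.smoothTransition.le_one _)⟩
  eq_zero_of_le t ht := Real.smoothTransition.zero_of_nonpos (sub_nonpos.2 ht)

variable {S : ℝ → ℝ} {k l : ℝ}

theorem IsTruncation.memW1pZero_comp (hS : IsTruncation S l) (hkl : k < l) {p : ENNReal}
    (hp1 : 1 ≤ p) (hp : p ≠ ⊤) (hΩ : IsOpen Ω) (hΩv : volume Ω < ⊤) {W : Plane → ℝ} {L : NNReal}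
    (hW : LipschitzWith L W) (hWk : ∀ x ∈ frontier Ω, W x ≤ k) :
    MemW1pZero p Ω (S ∘ W) (∇ (S ∘ W)) := by
  obtain ⟨M, hM⟩ := hS.exists_lipschitzWith
  obtain ⟨N, hN⟩ := hS.exists_norm_le
  have hsub : tsupport (S ∘ W) ⊆ {x | l ≤ W x} :=
    closure_minimal (fun x hx => le_of_not_ge fun hle => hx (hS.eq_zero_of_le _ hle))
      (isClosed_le continuous_const hW.continuous)
  exact memW1pZero_of_disjoint_tsupport_frontier hp1 hp hΩ hΩv (hM.comp hW) (fun x => hN (W x))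
    (Set.disjoint_left.2 fun x hx hxΩ => (hkl.trans_le (hsub hx)).not_ge (hWk x hxΩ))

theorem SobolevBoundaryLE.memW1pZero_comp {p : ℝ} (hp : 1 ≤ p) (hΩ : IsOpen Ω)
    (hΩv : volume Ω < ⊤) {v : Plane → ℝ} (hv : SobolevBoundaryLE p Ω v k) {G : Plane → Plane}
    (hG : HasWeakGradient Ω v G) (hGp : MemLp G (ENNReal.ofReal p) (volume.restrict Ω))
    (hS : IsTruncation S l) (hkl : k < l) :
    MemW1pZero (ENNReal.ofReal p) Ω (S ∘ v) (fun x => deriv S (v x) • G x) := by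
  have : IsFiniteMeasure (volume.restrict Ω) := ⟨by simpa using hΩv⟩
  have hp1 : 1 ≤ ENNReal.ofReal p := by simpa using ENNReal.ofReal_le_ofReal hp
  obtain ⟨W, hWL, hWk, hWv, hWG⟩ := hv.exists_lipschitzWith_approx (one_pos.trans_le hp) hΩ hG
  choose L hWL using hWL
  obtain ⟨M, hM⟩ := hS.exists_lipschitzWith
  obtain ⟨N, hN⟩ := hS.exists_norm_le
  have hvm : AEStronglyMeasurable v (volume.restrict Ω) := hG.1.aestronglyMeasurable
  have hS' : Continuous (deriv S) := hS.contDiff.continuous_deriv le_rfl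
  have hS'M : ∀ t, ‖deriv S t‖ ≤ M := fun t => norm_deriv_le_of_lipschitz hM
  have hchain : ∀ n, ∇ (S ∘ W n) =ᵐ[volume.restrict Ω] fun x => deriv S (W n x) • ∇ (W n) x :=
    fun n => by
      filter_upwards [ae_restrict_of_ae (hWL n).ae_differentiableAt] with x hx
      exact gradient_comp (hS.contDiff.differentiable one_ne_zero _) hx
  refine MemW1pZero.of_tendsto hp1 (fun n => hS.memW1pZero_comp hkl hp1 ENNReal.ofReal_ne_top hΩ
    hΩv (hWL n) (hWk n)) ?_ ?_ ?_ ?_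
  · exact MemLp.of_bound (hS.contDiff.continuous.comp_aestronglyMeasurable hvm) N
      (Eventually.of_forall fun x => hN (v x))
  · exact (hGp.norm.const_mul M).mono' ((hS'.comp_aestronglyMeasurable hvm).smul hGp.1)
      (Eventually.of_forall fun x => by rw [norm_smul]; gcongr; exact hS'M _)
  · refine tendsto_eLpNorm_sub_of_dominated (zero_lt_one.trans_le hp1).ne' ENNReal.ofReal_ne_top
      (fun n => (hS.contDiff.continuous.comp (hWL n).continuous).aestronglyMeasurable)
      (memLp_const (N : ℝ)) (fun n => Eventually.of_forall fun x => hN (W n x)) ?_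
    filter_upwards [hWv] with x hx
    exact (hS.contDiff.continuous.tendsto _).comp hx
  · refine (tendsto_eLpNorm_smul_sub (c := fun n x => deriv S (W n x))
      (c' := fun x => deriv S (v x)) hp1 ENNReal.ofReal_ne_top
      (fun n => (hS'.comp (hWL n).continuous).aestronglyMeasurable) (fun n x => hS'M _) ?_
      (fun n => (measurable_gradient (W n)).aestronglyMeasurable) hGp hWG).congr fun n =>
        eLpNorm_congr_ae ((hchain n).symm.sub (EventuallyEq.refl _ _))
    filter_upwards [hWv] with x hx
    exact (hS'.tendsto _).comp hx

end Truncation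

section MaximumPrinciple

variable {Ω : Set Plane} {v : Plane → ℝ} {G A : Plane → Plane} {p k : ℝ} {q : ENNReal}

theorem SobolevBoundaryLE.ae_le_of_lt [ENNReal.HolderTriple q (ENNReal.ofReal p) 1] (hp : 1 ≤ p)
    (hΩ : IsOpen Ω) (hΩv : volume Ω < ⊤) (hv : SobolevBoundaryLE p Ω v k)
    (hG : HasWeakGradient Ω v G) (hGp : MemLp G (ENNReal.ofReal p) (volume.restrict Ω))
    (hA : MemLp A q (volume.restrict Ω)) (hdiv : IsWeaklyDivFree Ω A)
    (hAG : ∀ᵐ x ∂(volume.restrict Ω), 0 ≤ inner ℝ (A x) (G x))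
    (hAG0 : ∀ᵐ x ∂(volume.restrict Ω), inner ℝ (A x) (G x) = 0 → G x = 0) {l : ℝ} (hkl : k < l) :
    ∀ᵐ x ∂(volume.restrict Ω), v x ≤ l := by
  have hp1 : 1 ≤ ENNReal.ofReal p := by simpa using ENNReal.ofReal_le_ofReal hp
  let S : ℝ → ℝ := fun t => Real.smoothTransition (t - l)
  have hS' : ∀ t, 0 ≤ deriv S t := fun t =>
    (Real.smoothTransition.monotone.comp (fun _ _ h => sub_le_sub_right h l)).deriv_nonneg
  have hSv := hv.memW1pZero_comp hp hΩ hΩv hG hGp (isTruncation_smoothTransition l) hkl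
  have hnonneg : ∀ᵐ x ∂(volume.restrict Ω), 0 ≤ inner ℝ (A x) (deriv S (v x) • G x) := by
    filter_upwards [hAG] with x hx
    rw [real_inner_smul_right]
    exact mul_nonneg (hS' _) hx
  have henergy := (integral_eq_zero_iff_of_nonneg_ae hnonneg
    (integrable_inner_of_memLp hA hSv.memLp_gradient)).1 (hSv.integral_inner_eq_zero hA hdiv)
  have hgrad : (fun x => deriv S (v x) • G x) =ᵐ[volume.restrict Ω] 0 := by
    filter_upwards [henergy, hAG0] with x hx hx0
    rw [real_inner_smul_right, Pi.zero_apply, mul_eq_zero] at hx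
    exact smul_eq_zero.2 (hx.imp_right hx0)
  filter_upwards [hSv.ae_eq_zero hp1 hΩv hgrad] with x hx
  exact sub_nonpos.1 (Real.smoothTransition.zero_iff_nonpos.1 hx)

theorem SobolevBoundaryLE.ae_le [ENNReal.HolderTriple q (ENNReal.ofReal p) 1] (hp : 1 ≤ p)
    (hΩ : IsOpen Ω) (hΩv : volume Ω < ⊤) (hv : SobolevBoundaryLE p Ω v k)
    (hG : HasWeakGradient Ω v G) (hGp : MemLp G (ENNReal.ofReal p) (volume.restrict Ω))
    (hA : MemLp A q (volume.restrict Ω)) (hdiv : IsWeaklyDivFree Ω A)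
    (hAG : ∀ᵐ x ∂(volume.restrict Ω), 0 ≤ inner ℝ (A x) (G x))
    (hAG0 : ∀ᵐ x ∂(volume.restrict Ω), inner ℝ (A x) (G x) = 0 → G x = 0) :
    ∀ᵐ x ∂(volume.restrict Ω), v x ≤ k := by
  have hl : ∀ n : ℕ, ∀ᵐ x ∂(volume.restrict Ω), v x ≤ k + 1 / ((n : ℝ) + 1) := fun n =>
    hv.ae_le_of_lt hp hΩ hΩv hG hGp hA hdiv hAG hAG0 (lt_add_of_pos_right k (by positivity))
  filter_upwards [ae_all_iff.2 hl] with x hx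
  exact ge_of_tendsto'
    (by simpa only [add_zero] using tendsto_one_div_add_atTop_nhds_zero_nat.const_add k) hx

end MaximumPrinciple

section PHarmonic

/-- The field `|Du|^{p-2} ∇u^i` whose divergence is the `i`-th component of the `p`-harmonic
system; it vanishes where `Du = 0`, whatever the value of the power. -/
noncomputable def pHarmonicFlux (p : ℝ) (Du : Fin 2 → Plane → Plane) (i : Fin 2) (x : Plane) :
    Plane :=
  jacobiNorm Du x ^ (p - 2) • Du i x

variable {p : ℝ} {Ω : Set Plane} {u : Plane → Plane} {Du : Fin 2 → Plane → Plane}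

theorem jacobiNorm_nonneg (Du : Fin 2 → Plane → Plane) (x : Plane) : 0 ≤ jacobiNorm Du x :=
  Real.sqrt_nonneg _

theorem norm_le_jacobiNorm (Du : Fin 2 → Plane → Plane) (i : Fin 2) (x : Plane) :
    ‖Du i x‖ ≤ jacobiNorm Du x := by
  refine Real.le_sqrt_of_sq_le ?_
  fin_cases i
  · exact le_add_of_nonneg_right (sq_nonneg _)
  · exact le_add_of_nonneg_left (sq_nonneg _)

theorem jacobiNorm_le_add (Du : Fin 2 → Plane → Plane) (x : Plane) :
    jacobiNorm Du x ≤ ‖Du 0 x‖ + ‖Du 1 x‖ :=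
  Real.sqrt_le_iff.2 ⟨by positivity, by
    nlinarith [mul_nonneg (norm_nonneg (Du 0 x)) (norm_nonneg (Du 1 x))]⟩

theorem memLp_jacobiNorm {q : ENNReal} {μ : Measure Plane} (hDu : ∀ i, MemLp (Du i) q μ) :
    MemLp (jacobiNorm Du) q μ :=
  ((hDu 0).norm.add (hDu 1).norm).mono'
    (Real.continuous_sqrt.comp_aestronglyMeasurable
      (((hDu 0).1.norm.pow 2).add ((hDu 1).1.norm.pow 2)))
    (Eventually.of_forall fun x =>
      (Real.norm_of_nonneg (jacobiNorm_nonneg Du x)).trans_le (jacobiNorm_le_add Du x))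

theorem norm_pHarmonicFlux_le (p : ℝ) (Du : Fin 2 → Plane → Plane) (i : Fin 2) (x : Plane) :
    ‖pHarmonicFlux p Du i x‖ ≤ jacobiNorm Du x ^ (p - 1) := by
  rw [pHarmonicFlux, norm_smul, Real.norm_of_nonneg (Real.rpow_nonneg (jacobiNorm_nonneg Du x) _)]
  rcases (jacobiNorm_nonneg Du x).eq_or_lt with hzero | hpos
  · rw [le_antisymm ((norm_le_jacobiNorm Du i x).trans_eq hzero.symm) (norm_nonneg _), mul_zero]
    exact Real.rpow_nonneg (jacobiNorm_nonneg Du x) _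
  · calc jacobiNorm Du x ^ (p - 2) * ‖Du i x‖
        ≤ jacobiNorm Du x ^ (p - 2) * jacobiNorm Du x := by
          gcongr
          exact norm_le_jacobiNorm Du i x
      _ = jacobiNorm Du x ^ (p - 1) := by
          rw [← Real.rpow_add_one hpos.ne']
          ring_nf

theorem memLp_pHarmonicFlux (hp : 1 ≤ p) {μ : Measure Plane}
    (hDu : ∀ i, MemLp (Du i) (ENNReal.ofReal p) μ) (i : Fin 2) :
    MemLp (pHarmonicFlux p Du i) (ENNReal.ofReal p / ENNReal.ofReal (p - 1)) μ := by
  have hJ := memLp_jacobiNorm hDu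
  have hJpow := hJ.norm_rpow_div (ENNReal.ofReal (p - 1))
  rw [ENNReal.toReal_ofReal (sub_nonneg.2 hp)] at hJpow
  refine hJpow.mono' ((hJ.1.aemeasurable.pow_const (p - 2)).aestronglyMeasurable.smul (hDu i).1)
    (Eventually.of_forall fun x => ?_)
  rw [Real.norm_of_nonneg (jacobiNorm_nonneg Du x)]
  exact norm_pHarmonicFlux_le p Du i x

theorem holderConjugate_ofReal_div_ofReal_sub_one (hp : 1 ≤ p) :
    ENNReal.HolderConjugate (ENNReal.ofReal p / ENNReal.ofReal (p - 1)) (ENNReal.ofReal p) := by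
  have hp0 : ENNReal.ofReal p ≠ 0 := (ENNReal.ofReal_pos.2 (by linarith)).ne'
  rw [ENNReal.holderConjugate_iff, ENNReal.inv_div (.inl ENNReal.ofReal_ne_top) (.inr hp0),
    ← one_div, ENNReal.div_add_div_same, ← ENNReal.ofReal_one,
    ← ENNReal.ofReal_add (sub_nonneg.2 hp) zero_le_one, sub_add_cancel,
    ENNReal.div_self hp0 ENNReal.ofReal_ne_top, ENNReal.ofReal_one]

theorem inner_pHarmonicFlux_self (p : ℝ) (Du : Fin 2 → Plane → Plane) (i : Fin 2) (x : Plane) :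
    inner ℝ (pHarmonicFlux p Du i x) (Du i x) = jacobiNorm Du x ^ (p - 2) * ‖Du i x‖ ^ 2 := by
  rw [pHarmonicFlux, real_inner_smul_left, real_inner_self_eq_norm_sq]

theorem inner_pHarmonicFlux_self_nonneg (p : ℝ) (Du : Fin 2 → Plane → Plane) (i : Fin 2)
    (x : Plane) : 0 ≤ inner ℝ (pHarmonicFlux p Du i x) (Du i x) := by
  rw [inner_pHarmonicFlux_self]
  exact mul_nonneg (Real.rpow_nonneg (jacobiNorm_nonneg Du x) _) (sq_nonneg _)

theorem eq_zero_of_inner_pHarmonicFlux_self_eq_zero {i : Fin 2} {x : Plane}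
    (h : inner ℝ (pHarmonicFlux p Du i x) (Du i x) = 0) : Du i x = 0 := by
  rw [inner_pHarmonicFlux_self, mul_eq_zero, sq_eq_zero_iff, norm_eq_zero] at h
  rcases (jacobiNorm_nonneg Du x).eq_or_lt with hzero | hpos
  · exact norm_le_zero_iff.1 ((norm_le_jacobiNorm Du i x).trans_eq hzero.symm)
  · exact h.resolve_left (Real.rpow_pos_of_pos hpos _).ne'

theorem IsPHarmonicMap.isWeaklyDivFree (hΩ : IsOpen Ω) (hu : IsPHarmonicMap p Ω u)
    (hDu : ∀ i, HasWeakGradient Ω (fun x => u x i) (Du i)) (i : Fin 2) :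
    IsWeaklyDivFree Ω (pHarmonicFlux p Du i) := by
  obtain ⟨Du', hDu', hweak⟩ := hu
  have hae : ∀ j, Du' j =ᵐ[volume.restrict Ω] Du j := fun j => (hDu' j).2.2.ae_eq hΩ (hDu j)
  intro φ hφ
  rw [← hweak i φ hφ]
  refine integral_congr_ae ?_
  filter_upwards [hae 0, hae 1, hae i] with x h0 h1 hi
  rw [pHarmonicFlux, real_inner_smul_left, jacobiNorm, jacobiNorm, h0, h1, hi]

end PHarmonic

theorem mainTheorem6_general (p : ℝ) (hp : 1 ≤ p) (Ω : Set Plane) (hΩo : IsOpen Ω)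
    (hΩv : volume Ω < ⊤) (u : Plane → Plane) (hu : MemW1pMap p Ω u) (hharm : IsPHarmonicMap p Ω u)
    (i : Fin 2) (k : ℝ) (hk : SobolevBoundaryLE p Ω (fun x => u x i) k) :
    ∀ᵐ x ∂(volume.restrict Ω), u x i ≤ k := by
  choose _ Du hDu hDup using hu
  have := holderConjugate_ofReal_div_ofReal_sub_one hp
  exact hk.ae_le hp hΩo hΩv (hDu i) (hDup i) (memLp_pHarmonicFlux hp hDup i)
    (hharm.isWeaklyDivFree hΩo hDu i)
    (Eventually.of_forall fun x => inner_pHarmonicFlux_self_nonneg p Du i x)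
    (Eventually.of_forall fun x => eq_zero_of_inner_pHarmonicFlux_self_eq_zero)

theorem mainTheorem6 (p : ℝ) (hp : 1 < p)
    (Ω : Set Plane) (hΩo : IsOpen Ω) (hΩc : IsConnected Ω) (hΩv : volume Ω < ⊤)
    (u : Plane → Plane) (hu : MemW1pMap p Ω u) (hharm : IsPHarmonicMap p Ω u)
    (i : Fin 2) (k : ℝ) (hk : SobolevBoundaryLE p Ω (fun x => u x i) k) :
    ∀ᵐ x ∂(volume.restrict Ω), u x i ≤ k :=
  mainTheorem6_general p hp.le Ω hΩo hΩv u hu hharm i k hk
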